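/- Let $p$ be a prime, let $S$ be a free pro-$p$-group on $n$ generators $x_1,\dots,x_n$, and let $R$ be the closed normal subgroup of $S$ generated by elements $\rho_1,\dots,\rho_r$; put $G=S/R$. Write $[x,y]=x^{-1}y^{-1}xy$, and let $(S_{(k)})_{k\ge 1}$ be the Zassenhaus $p$-filtration of $S$: $S_{(1)}=S$ and $S_{(k)}=S_{(\lceil k/p\rceil)}^{\,p}\prod_{i+j=k}[S_{(i)},S_{(j)}]$ for $k\ge 2$ (with $i,j\ge 1$, and with $H^p$ and $[H,K]$ denoting the closed subgroups generated by the $p$-th powers, respectively the commutators). Assume that there are integers $e_{i,j,k,m}$ such that for each $1\le m\le r$ $$\rho_m\equiv\prod_{1\le i<j\le n,\ k\le j}[[x_i,x_j],x_k]^{e_{i,j,k,m}} \pmod{S_{(4)}}$$ (the factors being multiplied, say, in lexicographic order of $(i,j,k)$; the order does not matter modulo $S_{(4)}$). Let $N$ be the number of tuples $(a_1,\dots,a_n,b_1,\dots,b_n,c_1,\dots,c_n)\in\mathbb F_p^{3n}$ such that 1. for each $1\le m\le r$, $$\sum_{i<j,\ k\le j}\bigl(a_ib_jc_k-a_jb_ic_k+a_kb_jc_i-a_kb_ic_j\bigr)\,e_{i,j,k,m}=0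 \quad\text{in }\mathbb F_p;$$ 2. the $3\times n$ matrix with rows $(a_1,\dots,a_n)$, $(b_1,\dots,b_n)$, $(c_1,\dots,c_n)$ has rank $3$. Let $U_4(\mathbb F_p)$ be the group of upper-triangular unipotent $4\times 4$ matrices over $\mathbb F_p$, and let $\mathrm{Epi}(G,U_4(\mathbb F_p))$ be the set of continuous surjective homomorphisms $G\to U_4(\mathbb F_p)$. Then this set is finite and $$|\mathrm{Epi}(G,U_4(\mathbb F_p))|=N\,p^{3n}.$$ -/

import Mathlib

open Matrix

/-- A topological group is a pro-`p`-group if it is profinite (compact, Hausdorff, totally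
disconnected) and all its open normal subgroups have index a power of `p`. -/
structure IsProP (p : ℕ) (G : Type*) [Group G] [TopologicalSpace G] [IsTopologicalGroup G] :
    Prop where
  compact : CompactSpace G
  hausdorff : T2Space G
  totally_disconnected : TotallyDisconnectedSpace G
  index_eq : ∀ V : OpenNormalSubgroup G, ∃ k : ℕ, V.toSubgroup.index = p ^ k

/-- `S` is a free pro-`p`-group on the generators `x 0, …, x (n - 1)`: it is a pro-`p`-group, and
every map from the generators to a finite (discrete) `p`-group extends uniquely to a continuous
homomorphism.  (Passing to inverse limits, the same then holds for all pro-`p`-groups as targets.)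
-/
structure IsFreeProP (p : ℕ) {n : ℕ} (S : Type*) [Group S] [TopologicalSpace S]
    [IsTopologicalGroup S] (x : Fin n → S) : Prop where
  isProP : IsProP p S
  existsUnique_lift : ∀ (P : Type) [Group P] [Finite P] [TopologicalSpace P] [DiscreteTopology P],
    IsPGroup p P → ∀ f : Fin n → P, ∃! φ : S →ₜ* P, ∀ i, φ (x i) = f i

/-- The commutator `[x, y] = x⁻¹ y⁻¹ x y`. -/
def grpComm {G : Type*} [Group G] (x y : G) : G := x⁻¹ * y⁻¹ * x * y

/-- The smallest closed subgroup containing the commutators `[x, y]`, `x ∈ H`, `y ∈ K`. -/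
def closedCommutator {G : Type*} [Group G] [TopologicalSpace G] [IsTopologicalGroup G]
    (H K : Subgroup G) : Subgroup G :=
  (Subgroup.closure {g | ∃ x ∈ H, ∃ y ∈ K, grpComm x y = g}).topologicalClosure

/-- The smallest closed subgroup containing the `m`-th powers `x ^ m`, `x ∈ H`. -/
def closedPower {G : Type*} [Group G] [TopologicalSpace G] [IsTopologicalGroup G]
    (m : ℕ) (H : Subgroup G) : Subgroup G :=
  (Subgroup.closure {g | ∃ x ∈ H, x ^ m = g}).topologicalClosure

theorem ceilDiv_lt (p n : ℕ) [hp : Fact p.Prime] : (n + 2) ⌈/⌉ p < n + 2 := by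
  have h2 := hp.out.two_le
  rw [Nat.ceilDiv_eq_add_pred_div, Nat.div_lt_iff_lt_mul (by omega)]
  obtain ⟨q, rfl⟩ := Nat.exists_eq_add_of_le h2
  nlinarith [Nat.zero_le (n * q), show n + 2 + (2 + q) - 1 = n + q + 3 by omega]

/-- The Zassenhaus `p`-filtration: `G_(1) = G` and
`G_(n) = G_(⌈n/p⌉)^p ∏_{i+j=n} [G_(i), G_(j)]` for `n ≥ 2`, where `i, j ≥ 1` (the subgroups in the
product are normal, so that their product is their supremum).  The value at the index `0` is a
convention and is not used. -/
def zassenhaus (p : ℕ) [Fact p.Prime] (G : Type*) [Group G] [TopologicalSpace G]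
    [IsTopologicalGroup G] : ℕ → Subgroup G
  | 0 => ⊤
  | 1 => ⊤
  | n + 2 =>
    closedPower p (zassenhaus p G ((n + 2) ⌈/⌉ p)) ⊔
      ⨆ i : Fin (n + 1),
        closedCommutator (zassenhaus p G (i.1 + 1)) (zassenhaus p G (n + 1 - i.1))
termination_by n => n
decreasing_by
  · exact ceilDiv_lt p n
  · omega
  · omega

/-- The closed normal subgroup of `S` generated by a family of elements. -/
def closedNormalClosure {S ι : Type*} [Group S] [TopologicalSpace S] [IsTopologicalGroup S]
    (ρ : ι → S) : Subgroup S :=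
  (Subgroup.normalClosure (Set.range ρ)).topologicalClosure

instance closedNormalClosure.normal {S ι : Type*} [Group S] [TopologicalSpace S]
    [IsTopologicalGroup S] (ρ : ι → S) : (closedNormalClosure ρ).Normal :=
  Subgroup.is_normal_topologicalClosure _

theorem inv_upper {d : ℕ} {R : Type*} [CommRing R] (g : GL (Fin d) R)
    (h0 : ∀ i j, j < i → g i j = 0) (h1 : ∀ i, g i i = 1) :
    (∀ i j, j < i → g⁻¹ i j = 0) ∧ ∀ i, g⁻¹ i i = 1 := by
  have hT : (g : Matrix (Fin d) (Fin d) R).BlockTriangular id := fun i j h => h0 i j h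
  let : Invertible (g : Matrix (Fin d) (Fin d) R) := g.invertible
  have hT' : ((g : Matrix (Fin d) (Fin d) R)⁻¹).BlockTriangular id :=
    blockTriangular_inv_of_blockTriangular hT
  have h0' : ∀ i j, j < i → g⁻¹ i j = 0 := fun i j h => by
    have := hT' (i := i) (j := j) h
    rwa [← GeneralLinearGroup.coe_inv] at this
  refine ⟨h0', fun i => ?_⟩
  have h : ((g * g⁻¹ : GL (Fin d) R) : Matrix (Fin d) (Fin d) R) i i = 1 := by simp
  rw [GeneralLinearGroup.coe_mul, Matrix.mul_apply, Finset.sum_eq_single i] at h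
  · rwa [h1, one_mul] at h
  · intro j _ hj
    rcases lt_or_gt_of_ne hj with h | h
    · rw [h0 i j h, zero_mul]
    · rw [h0' j i h, mul_zero]
  · simp

/-- `U_d(R)`: the group of upper-triangular unipotent `d × d` matrices over `R`.  For `R = ZMod p`
with its discrete topology, the topology inherited from `GL` is the discrete one. -/
def unipotentGroup (d : ℕ) (R : Type*) [CommRing R] : Subgroup (GL (Fin d) R) where
  carrier := {g | (∀ i j, j < i → g i j = 0) ∧ ∀ i, g i i = 1}
  one_mem' := ⟨fun i j h => Matrix.one_apply_ne h.ne', fun i => Matrix.one_apply_eq i⟩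
  mul_mem' := by
    rintro a b ⟨ha0, ha1⟩ ⟨hb0, hb1⟩
    refine ⟨fun i j h => ?_, fun i => ?_⟩
    · rw [GeneralLinearGroup.coe_mul, Matrix.mul_apply]
      refine Finset.sum_eq_zero fun k _ => ?_
      rcases lt_or_ge k i with hk | hk
      · rw [ha0 i k hk, zero_mul]
      · rw [hb0 k j (h.trans_le hk), mul_zero]
    · rw [GeneralLinearGroup.coe_mul, Matrix.mul_apply, Finset.sum_eq_single i]
      · rw [ha1, hb1, one_mul]
      · intro k _ hk
        rcases lt_or_gt_of_ne hk with h | h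
        · rw [ha0 i k h, zero_mul]
        · rw [hb0 k i h, mul_zero]
      · simp
  inv_mem' := fun {g} h => inv_upper g h.1 h.2

/-- `Epi(G, H)`: the continuous surjective homomorphisms from `G` to `H`. -/
def Epi (G H : Type*) [Group G] [TopologicalSpace G] [Group H] [TopologicalSpace H] : Type _ :=
  {f : G →ₜ* H // Function.Surjective f}

/-- `∏_{i < j, k ≤ j} [[x_i, x_j], x_k] ^ e_{i,j,k}`, multiplied in the lexicographic order of the
triples `(i, j, k)`. -/
def tripleCommProd {n : ℕ} {S : Type*} [Group S] (x : Fin n → S)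
    (e : Fin n → Fin n → Fin n → ℤ) : S :=
  ((List.finRange n).map fun i => ((List.finRange n).map fun j =>
    ((List.finRange n).map fun k =>
      if i < j ∧ k ≤ j then grpComm (grpComm (x i) (x j)) (x k) ^ e i j k else 1).prod).prod).prod

/-- The triples `(a, b, c)` of vectors in `F_p ^ n` that span a space of rank `3` and satisfy, for
every `m`, the cubic equation with the coefficients `e_{i,j,k,m}` (`i < j`, `k ≤ j`). -/
def cubicSolutions (p n r : ℕ) (e : Fin n → Fin n → Fin n → Fin r → ℤ) :
    Set ((Fin n → ZMod p) × (Fin n → ZMod p) × (Fin n → ZMod p)) :=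
  {(a, b, c) |
    (∀ m : Fin r, ∑ i, ∑ j, ∑ k, (if i < j ∧ k ≤ j then
      (a i * b j * c k - a j * b i * c k + a k * b j * c i - a k * b i * c j) * (e i j k m : ZMod p)
      else 0) = 0) ∧
    (Matrix.of ![a, b, c]).rank = 3}

/-! A continuous homomorphism from `S ⧸ closedNormalClosure ρ` is one from `S` that kills every
relator, and by freeness it is a tuple of matrices, the images of the generators. It is surjective
exactly when the tuple generates (`IsFreeProP.nonempty_epi_equiv`).

Filter the unipotent group by superdiagonals. Commutators add indices and, in characteristic `p`,
`p`-th powers multiply them by `p`, so every homomorphism sends the `k`-th Zassenhaus subgroup into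
the `k`-th step (`map_mem_filtration_of_mem_zassenhaus`). For `4 × 4` matrices the fourth step is
trivial, so each relator may be replaced by its product of triple commutators. These lie in the
third step, which is the corner entry alone. There commutators act as Lie brackets and give a cubic
form in the superdiagonals (`tripleCommProd_eq_one_iff`).

The superdiagonal map plays the role of the Frattini quotient: a tuple generates iff its
superdiagonals span `F_p ^ 3`, which is the rank condition (`closure_range_eq_top_iff`). Both
conditions thus see only superdiagonals. The three other entries of each of the `n` matrices are
free and contribute `p ^ (3 * n)`. -/

namespace UnipotentGroup

/-! ### Matrices vanishing below a given superdiagonal. -/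

/-- Matrices whose entries below the `k`-th superdiagonal vanish. -/
def UpperFrom {d : ℕ} {R : Type*} [CommRing R] (k : ℕ) (X : Matrix (Fin d) (Fin d) R) : Prop :=
  ∀ i j : Fin d, j.1 < i.1 + k → X i j = 0

namespace UpperFrom

variable {d : ℕ} {R : Type*} [CommRing R] {k l : ℕ} {X Y : Matrix (Fin d) (Fin d) R}

theorem mul (hX : UpperFrom k X) (hY : UpperFrom l Y) : UpperFrom (k + l) (X * Y) := by
  intro i j h
  rw [Matrix.mul_apply]
  refine Finset.sum_eq_zero fun m _ => ?_
  rcases lt_or_ge m.1 (i.1 + k) with hm | hm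
  · rw [hX i m hm, zero_mul]
  · rw [hY m j (by omega), mul_zero]

theorem add (hX : UpperFrom k X) (hY : UpperFrom k Y) : UpperFrom k (X + Y) := fun i j h => by
  rw [Matrix.add_apply, hX i j h, hY i j h, add_zero]

theorem sub (hX : UpperFrom k X) (hY : UpperFrom k Y) : UpperFrom k (X - Y) := fun i j h => by
  rw [Matrix.sub_apply, hX i j h, hY i j h, sub_zero]

theorem neg (hX : UpperFrom k X) : UpperFrom k (-X) := fun i j h => by
  rw [Matrix.neg_apply, hX i j h, neg_zero]

theorem mono (hX : UpperFrom k X) (h : l ≤ k) : UpperFrom l X := fun i j hij =>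
  hX i j (by omega)

theorem one : UpperFrom 0 (1 : Matrix (Fin d) (Fin d) R) := fun i j h =>
  Matrix.one_apply_ne (by rintro rfl; omega)

theorem pow (hX : UpperFrom k X) (m : ℕ) : UpperFrom (k * m) (X ^ m) := by
  induction m with
  | zero => simpa using one
  | succ m ih => rw [pow_succ, Nat.mul_succ]; exact ih.mul hX

theorem eq_zero (hX : UpperFrom k X) (h : d ≤ k) : X = 0 := by
  ext i j
  exact hX i j (by omega)

end UpperFrom

/-! ### The superdiagonal filtration and its compatibility with the Zassenhaus filtration. -/

section Filtration

variable {d : ℕ} {R : Type*} [CommRing R]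

/-- The matrix underlying an element of the unipotent group. -/
abbrev mat (g : unipotentGroup d R) : Matrix (Fin d) (Fin d) R := g.1.1

theorem mat_mul (g h : unipotentGroup d R) : mat (g * h) = mat g * mat h := rfl

theorem mat_one : mat (1 : unipotentGroup d R) = 1 := rfl

theorem mat_pow (g : unipotentGroup d R) (m : ℕ) : mat (g ^ m) = mat g ^ m := rfl

theorem mat_inv_mul (g : unipotentGroup d R) : mat g⁻¹ * mat g = 1 := by
  rw [← mat_mul, inv_mul_cancel, mat_one]

theorem mat_injective : Function.Injective (mat : unipotentGroup d R → _) := fun _ _ h =>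
  Subtype.ext (Units.ext h)

theorem upperFrom_mat_sub_one (g : unipotentGroup d R) : UpperFrom 1 (mat g - 1) := by
  intro i j h
  rcases eq_or_ne i j with rfl | hij
  · rw [Matrix.sub_apply, Matrix.one_apply_eq, sub_eq_zero]
    exact g.2.2 i
  · rw [Matrix.sub_apply, Matrix.one_apply_ne hij, sub_zero]
    exact g.2.1 i j (by rw [Fin.lt_def]; have := Fin.val_ne_of_ne hij; omega)

theorem upperFrom_mat (g : unipotentGroup d R) : UpperFrom 0 (mat g) := by
  simpa using ((upperFrom_mat_sub_one g).mono (Nat.zero_le 1)).add UpperFrom.one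

/-- The subgroup of unipotent matrices congruent to `1` below the `k`-th superdiagonal. -/
def filtration (d : ℕ) (R : Type*) [CommRing R] (k : ℕ) : Subgroup (unipotentGroup d R) where
  carrier := {g | UpperFrom k (mat g - 1)}
  one_mem' := fun i j _ => by simp [mat_one]
  mul_mem' := by
    intro a b ha hb
    have h := (ha.mul (upperFrom_mat b)).add hb
    have e : mat (a * b) - 1 = (mat a - 1) * mat b + (mat b - 1) := by
      rw [mat_mul]; noncomm_ring
    exact fun i j hij => by rw [e]; exact h i j (by simpa using hij)
  inv_mem' := by
    intro a ha
    have h := ((upperFrom_mat a⁻¹).mul ha).neg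
    have e : mat a⁻¹ - 1 = -(mat a⁻¹ * (mat a - 1)) := by
      rw [mul_sub, mat_inv_mul]; noncomm_ring
    exact fun i j hij => by rw [e]; exact h i j (by simpa using hij)

theorem mem_filtration {k : ℕ} {g : unipotentGroup d R} :
    g ∈ filtration d R k ↔ UpperFrom k (mat g - 1) := Iff.rfl

theorem filtration_one : filtration d R 1 = ⊤ := by
  rw [eq_top_iff]
  exact fun g _ => upperFrom_mat_sub_one g

theorem filtration_zero : filtration d R 0 = ⊤ := by
  rw [eq_top_iff]
  exact fun g _ => (upperFrom_mat_sub_one g).mono zero_le_one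

theorem filtration_self : filtration d R d = ⊥ := by
  rw [eq_bot_iff]
  intro g hg
  exact Subgroup.mem_bot.2 (mat_injective (sub_eq_zero.1 (UpperFrom.eq_zero hg le_rfl)))

theorem filtration_anti : Antitone (filtration d R) := fun _ _ h _ hg =>
  UpperFrom.mono hg h

/-- Exact form of "commutator minus one is the bracket up to a unipotent factor": write `1` as `g⁻¹
h⁻¹ (h g)` and subtract. Both the index estimate and the leading term of a commutator come from it.
-/
theorem mat_grpComm_sub_one (g h : unipotentGroup d R) :
    mat (grpComm g h) - 1 = mat g⁻¹ * mat h⁻¹ *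
      ((mat g - 1) * (mat h - 1) - (mat h - 1) * (mat g - 1)) := by
  have e : mat (grpComm g h) = mat g⁻¹ * mat h⁻¹ * mat g * mat h := rfl
  have e1 : mat g⁻¹ * mat h⁻¹ * (mat h * mat g) = 1 := by
    rw [mul_assoc, ← mul_assoc (mat h⁻¹), mat_inv_mul, one_mul, mat_inv_mul]
  calc mat (grpComm g h) - 1
      = mat g⁻¹ * mat h⁻¹ * mat g * mat h - mat g⁻¹ * mat h⁻¹ * (mat h * mat g) := by rw [e, e1]
    _ = _ := by noncomm_ring

theorem grpComm_mem_filtration {k l : ℕ} {g h : unipotentGroup d R} (hg : g ∈ filtration d R k)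
    (hh : h ∈ filtration d R l) : grpComm g h ∈ filtration d R (k + l) := by
  rw [mem_filtration, mat_grpComm_sub_one]
  have h1 := (hg.mul hh).sub ((add_comm l k) ▸ hh.mul hg)
  simpa using ((upperFrom_mat g⁻¹).mul (upperFrom_mat h⁻¹)).mul h1

/-- Modulo the next step of the filtration, the group commutator is the Lie bracket. -/
theorem upperFrom_grpComm_sub_bracket {k l : ℕ} {g h : unipotentGroup d R}
    (hg : g ∈ filtration d R k) (hh : h ∈ filtration d R l) :
    UpperFrom (k + l + 1) (mat (grpComm g h) - 1 -
      ((mat g - 1) * (mat h - 1) - (mat h - 1) * (mat g - 1))) := by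
  have e : mat (grpComm g h) - 1 - ((mat g - 1) * (mat h - 1) - (mat h - 1) * (mat g - 1)) =
      (mat (g⁻¹ * h⁻¹) - 1) * ((mat g - 1) * (mat h - 1) - (mat h - 1) * (mat g - 1)) := by
    rw [mat_grpComm_sub_one, mat_mul, sub_mul (mat g⁻¹ * mat h⁻¹) 1, one_mul]
  have h1 := (hg.mul hh).sub ((add_comm l k) ▸ hh.mul hg)
  rw [e, add_comm]
  exact (upperFrom_mat_sub_one _).mul h1

variable {p : ℕ} [Fact p.Prime] [CharP R p]

theorem pow_mem_filtration {k : ℕ} {g : unipotentGroup d R} (hg : g ∈ filtration d R k) (m : ℕ) :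
    g ^ p ^ m ∈ filtration d R (k * p ^ m) := by
  -- The matrix ring inherits characteristic `p` only for a nonempty index type.
  rcases Nat.eq_zero_or_pos d with rfl | hd
  · exact fun i => i.elim0
  have : Nonempty (Fin d) := ⟨⟨0, hd⟩⟩
  have e : mat (g ^ p ^ m) - 1 = (mat g - 1) ^ p ^ m := by
    rw [mat_pow, sub_pow_char_pow_of_commute p m (Commute.one_right _), one_pow]
  rw [mem_filtration, e]
  exact UpperFrom.pow hg _

theorem isPGroup_unipotentGroup (d : ℕ) (R : Type*) [CommRing R] (p : ℕ) [Fact p.Prime]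
    [CharP R p] : IsPGroup p (unipotentGroup d R) := by
  intro g
  refine ⟨d, ?_⟩
  have h : g ^ p ^ d ∈ filtration d R (1 * p ^ d) :=
    pow_mem_filtration (by rw [filtration_one]; trivial) d
  -- The exponent `p ^ d` works because `d ≤ p ^ d` and the `d`-th step is trivial.
  have h2 := filtration_anti (show d ≤ 1 * p ^ d by
    rw [one_mul]; exact (Nat.lt_pow_self (Fact.out : p.Prime).one_lt).le) h
  rwa [filtration_self, Subgroup.mem_bot] at h2

variable [TopologicalSpace (unipotentGroup d R)] [DiscreteTopology (unipotentGroup d R)]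

/-- Strong induction along the recursion. Since the target is discrete, preimages of filtration
steps are closed, so it suffices to check the generating powers and commutators. -/
theorem map_mem_filtration_of_mem_zassenhaus {S : Type*} [Group S] [TopologicalSpace S]
    [IsTopologicalGroup S] (φ : S →ₜ* unipotentGroup d R) (k : ℕ) :
    zassenhaus p S k ≤ (filtration d R k).comap (φ : S →* unipotentGroup d R) := by
  induction k using Nat.strong_induction_on with
  | _ k ih =>
    have hclosed : IsClosed
        (((filtration d R k).comap (φ : S →* unipotentGroup d R) : Subgroup S) : Set S) :=
      (isClosed_discrete (filtration d R k : Set (unipotentGroup d R))).preimage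
        φ.continuous_toFun
    match k, ih, hclosed with
    | 0, _, _ => rw [filtration_zero]; exact fun _ _ => trivial
    | 1, _, _ => rw [filtration_one]; exact fun _ _ => trivial
    | n + 2, ih, hclosed =>
      rw [zassenhaus]
      refine sup_le ?_ (iSup_le fun i => ?_)
      · refine Subgroup.topologicalClosure_minimal _ ((Subgroup.closure_le _).2 ?_) hclosed
        rintro _ ⟨y, hy, rfl⟩
        have h1 := pow_mem_filtration (p := p) (ih _ (ceilDiv_lt p n) hy) 1
        rw [pow_one] at h1
        have h2 : n + 2 ≤ (n + 2) ⌈/⌉ p * p := by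
          have := le_smul_ceilDiv (b := n + 2) (Fact.out : p.Prime).pos
          rwa [smul_eq_mul, mul_comm] at this
        have h3 := filtration_anti h2 h1
        rw [SetLike.mem_coe, Subgroup.mem_comap, map_pow]
        exact h3
      · refine Subgroup.topologicalClosure_minimal _ ((Subgroup.closure_le _).2 ?_) hclosed
        rintro _ ⟨y, hy, z, hz, rfl⟩
        have h1 := grpComm_mem_filtration (ih _ (by omega) hy) (ih _ (by omega) hz)
        rw [show i.1 + 1 + (n + 1 - i.1) = n + 2 by omega] at h1
        rw [SetLike.mem_coe, Subgroup.mem_comap]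
        simpa [grpComm] using h1

end Filtration

/-! ### Explicit computations with unipotent 4 × 4 matrices. -/

section Four

variable {R : Type*} [CommRing R]

/-- The cubic form giving the corner entry of a triple commutator. -/
def cubicForm (a b c : Fin 3 → R) : R :=
  a 0 * b 1 * c 2 - b 0 * a 1 * c 2 + c 0 * b 1 * a 2 - c 0 * a 1 * b 2

/-- The superdiagonal of a unipotent `4 × 4` matrix. -/
def superdiag (g : unipotentGroup 4 R) : Fin 3 → R := ![mat g 0 1, mat g 1 2, mat g 2 3]

theorem mat_entries (g : unipotentGroup 4 R) :
    mat g 0 0 = 1 ∧ mat g 1 1 = 1 ∧ mat g 2 2 = 1 ∧ mat g 3 3 = 1 ∧ mat g 1 0 = 0 ∧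
      mat g 2 0 = 0 ∧ mat g 2 1 = 0 ∧ mat g 3 0 = 0 ∧ mat g 3 1 = 0 ∧ mat g 3 2 = 0 :=
  ⟨g.2.2 0, g.2.2 1, g.2.2 2, g.2.2 3, g.2.1 1 0 (by decide), g.2.1 2 0 (by decide),
    g.2.1 2 1 (by decide), g.2.1 3 0 (by decide), g.2.1 3 1 (by decide), g.2.1 3 2 (by decide)⟩

theorem superdiag_mul (g h : unipotentGroup 4 R) :
    superdiag (g * h) = superdiag g + superdiag h := by
  obtain ⟨g1, g2, g3, g4, g5, g6, g7, g8, g9, g10⟩ := mat_entries g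
  obtain ⟨h1, h2, h3, h4, h5, h6, h7, h8, h9, h10⟩ := mat_entries h
  ext i
  fin_cases i <;>
    simp [superdiag, mat_mul, Matrix.mul_apply, Fin.sum_univ_four, -Subgroup.coe_mul, *] <;> ring

/-- The superdiagonal as a homomorphism. -/
def superdiagHom (R : Type*) [CommRing R] :
    unipotentGroup 4 R →* Multiplicative (Fin 3 → R) :=
  MonoidHom.mk' (fun g => Multiplicative.ofAdd (superdiag g)) fun g h => by
    rw [superdiag_mul, ofAdd_add]

theorem mem_filtration_two {g : unipotentGroup 4 R} :
    g ∈ filtration 4 R 2 ↔ superdiag g = 0 := by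
  obtain ⟨g1, g2, g3, g4, g5, g6, g7, g8, g9, g10⟩ := mat_entries g
  constructor
  · intro h
    have h1 := h 0 1 (by decide)
    have h2 := h 1 2 (by decide)
    have h3 := h 2 3 (by decide)
    ext i
    fin_cases i
    · simpa [superdiag] using h1
    · simpa [superdiag] using h2
    · simpa [superdiag] using h3
  · intro h i j hij
    have h1 : mat g 0 1 = 0 := congrFun h 0
    have h2 : mat g 1 2 = 0 := congrFun h 1
    have h3 : mat g 2 3 = 0 := congrFun h 2
    fin_cases i <;> fin_cases j <;> simp at hij <;> simp [*]

theorem mem_filtration_three {g : unipotentGroup 4 R} (hg : g ∈ filtration 4 R 2) :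
    g ∈ filtration 4 R 3 ↔ mat g 0 2 = 0 ∧ mat g 1 3 = 0 := by
  obtain ⟨g1, g2, g3, g4, g5, g6, g7, g8, g9, g10⟩ := mat_entries g
  constructor
  · intro h
    have h1 := h 0 2 (by decide)
    have h2 := h 1 3 (by decide)
    exact ⟨by simpa using h1, by simpa using h2⟩
  · rintro ⟨h02, h13⟩ i j hij
    rw [mem_filtration_two] at hg
    have h1 : mat g 0 1 = 0 := congrFun hg 0
    have h2 : mat g 1 2 = 0 := congrFun hg 1
    have h3 : mat g 2 3 = 0 := congrFun hg 2
    fin_cases i <;> fin_cases j <;> simp at hij <;> simp [*]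

theorem eq_one_of_mem_filtration_three {g : unipotentGroup 4 R} (hg : g ∈ filtration 4 R 3)
    (h : mat g 0 3 = 0) : g = 1 := by
  rw [← Subgroup.mem_bot, ← filtration_self]
  intro i j hij
  by_cases h3 : j.1 < i.1 + 3
  · exact hg i j h3
  · obtain rfl : i = 0 := Fin.ext (by simp; omega)
    obtain rfl : j = 3 := Fin.ext (by simp; omega)
    simpa using h

/-- In `gh - 1 = (g - 1) + (h - 1) + (g - 1)(h - 1)` the last term would start on the fourth
superdiagonal, so it vanishes. -/
theorem mat_mul_of_mem_filtration_two {g h : unipotentGroup 4 R} (hg : g ∈ filtration 4 R 2)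
    (hh : h ∈ filtration 4 R 2) :
    mat (g * h) 0 2 = mat g 0 2 + mat h 0 2 ∧ mat (g * h) 1 3 = mat g 1 3 + mat h 1 3 ∧
      mat (g * h) 0 3 = mat g 0 3 + mat h 0 3 := by
  obtain ⟨g1, g2, g3, g4, g5, g6, g7, g8, g9, g10⟩ := mat_entries g
  obtain ⟨h1, h2, h3, h4, h5, h6, h7, h8, h9, h10⟩ := mat_entries h
  rw [mem_filtration_two] at hg hh
  have k1 : mat g 0 1 = 0 := congrFun hg 0
  have k2 : mat g 1 2 = 0 := congrFun hg 1
  have k3 : mat g 2 3 = 0 := congrFun hg 2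
  have l1 : mat h 0 1 = 0 := congrFun hh 0
  have l2 : mat h 1 2 = 0 := congrFun hh 1
  have l3 : mat h 2 3 = 0 := congrFun hh 2
  refine ⟨?_, ?_, ?_⟩ <;>
    simp [mat_mul, Matrix.mul_apply, Fin.sum_univ_four, -Subgroup.coe_mul, *] <;> ring

/-- The entries above the superdiagonal, as a homomorphism on the second filtration step. -/
def upperHom (R : Type*) [CommRing R] : filtration 4 R 2 →* Multiplicative (Fin 3 → R) :=
  MonoidHom.mk' (fun g => Multiplicative.ofAdd ![mat g.1 0 2, mat g.1 1 3, mat g.1 0 3])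
    fun g h => by
      obtain ⟨h1, h2, h3⟩ := mat_mul_of_mem_filtration_two g.2 h.2
      rw [← ofAdd_add]
      congr 1
      ext i
      fin_cases i
      exacts [h1, h2, h3]

theorem mat_pow_of_mem_filtration_two {g : unipotentGroup 4 R} (hg : g ∈ filtration 4 R 2)
    (m : ℤ) : mat (g ^ m) 0 2 = m * mat g 0 2 ∧ mat (g ^ m) 1 3 = m * mat g 1 3 ∧
      mat (g ^ m) 0 3 = m * mat g 0 3 := by
  have h := congrArg Multiplicative.toAdd (map_zpow (upperHom R) ⟨g, hg⟩ m)
  rw [toAdd_zpow] at h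
  refine ⟨?_, ?_, ?_⟩
  · simpa [upperHom] using congrFun h 0
  · simpa [upperHom] using congrFun h 1
  · simpa [upperHom] using congrFun h 2

theorem mem_filtration_one (g : unipotentGroup 4 R) : g ∈ filtration 4 R 1 := by
  rw [filtration_one]; trivial

theorem mat_grpComm (g h : unipotentGroup 4 R) :
    mat (grpComm g h) 0 2 = superdiag g 0 * superdiag h 1 - superdiag h 0 * superdiag g 1 ∧
      mat (grpComm g h) 1 3 = superdiag g 1 * superdiag h 2 - superdiag h 1 * superdiag g 2 := by
  have H := upperFrom_grpComm_sub_bracket (mem_filtration_one g) (mem_filtration_one h)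
  obtain ⟨g1, g2, g3, g4, g5, g6, g7, g8, g9, g10⟩ := mat_entries g
  obtain ⟨h1, h2, h3, h4, h5, h6, h7, h8, h9, h10⟩ := mat_entries h
  have H1 := H 0 2 (by decide)
  have H2 := H 1 3 (by decide)
  simp only [Matrix.sub_apply, Matrix.mul_apply, Fin.sum_univ_four, Matrix.one_apply, sub_eq_zero,
    *] at H1 H2
  constructor
  · simpa [superdiag] using H1
  · simpa [superdiag] using H2

/-- With indices 2 and 1 the error in the bracket approximation starts on the fourth superdiagonal,
so the bracket is exact at the corner. -/
theorem mat_grpComm_of_mem_filtration_two {g : unipotentGroup 4 R} (hg : g ∈ filtration 4 R 2)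
    (h : unipotentGroup 4 R) :
    mat (grpComm g h) 0 3 = mat g 0 2 * superdiag h 2 - superdiag h 0 * mat g 1 3 := by
  have H := upperFrom_grpComm_sub_bracket hg (mem_filtration_one h)
  obtain ⟨g1, g2, g3, g4, g5, g6, g7, g8, g9, g10⟩ := mat_entries g
  obtain ⟨h1, h2, h3, h4, h5, h6, h7, h8, h9, h10⟩ := mat_entries h
  rw [mem_filtration_two] at hg
  have k1 : mat g 0 1 = 0 := congrFun hg 0
  have k2 : mat g 1 2 = 0 := congrFun hg 1
  have k3 : mat g 2 3 = 0 := congrFun hg 2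
  have H1 := H 0 3 (by decide)
  simp only [Matrix.sub_apply, Matrix.mul_apply, Fin.sum_univ_four, Matrix.one_apply, sub_eq_zero,
    *] at H1
  simpa [superdiag] using H1

theorem grpComm_mem_filtration_two (g h : unipotentGroup 4 R) :
    grpComm g h ∈ filtration 4 R 2 :=
  grpComm_mem_filtration (mem_filtration_one g) (mem_filtration_one h)

theorem grpComm_grpComm_mem_filtration_three (f g h : unipotentGroup 4 R) :
    grpComm (grpComm f g) h ∈ filtration 4 R 3 :=
  grpComm_mem_filtration (grpComm_mem_filtration_two f g) (mem_filtration_one h)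

theorem mat_grpComm_grpComm (f g h : unipotentGroup 4 R) :
    mat (grpComm (grpComm f g) h) 0 3 =
      cubicForm (superdiag f) (superdiag g) (superdiag h) := by
  rw [mat_grpComm_of_mem_filtration_two (grpComm_mem_filtration_two f g), (mat_grpComm f g).1,
    (mat_grpComm f g).2, cubicForm]
  ring

theorem list_prod_mem_and_corner {ι : Type*} (l : List ι) (F : ι → unipotentGroup 4 R)
    (hF : ∀ i, F i ∈ filtration 4 R 3) :
    (l.map F).prod ∈ filtration 4 R 3 ∧
      mat (l.map F).prod 0 3 = (l.map fun i => mat (F i) 0 3).sum := by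
  induction l with
  | nil => exact ⟨one_mem _, by simp [mat_one]⟩
  | cons i l ih =>
    have h32 := filtration_anti (d := 4) (R := R) (show 2 ≤ 3 by decide)
    simp only [List.map_cons, List.prod_cons, List.sum_cons]
    exact ⟨mul_mem (hF i) ih.1,
      by rw [(mat_mul_of_mem_filtration_two (h32 (hF i)) (h32 ih.1)).2.2, ih.2]⟩

theorem tripleCommProd_mem_and_corner {n : ℕ} (x : Fin n → unipotentGroup 4 R)
    (e : Fin n → Fin n → Fin n → ℤ) :
    tripleCommProd x e ∈ filtration 4 R 3 ∧ mat (tripleCommProd x e) 0 3 =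
      ∑ i, ∑ j, ∑ k, if i < j ∧ k ≤ j then
        cubicForm (superdiag (x i)) (superdiag (x j)) (superdiag (x k)) * (e i j k : R) else 0 := by
  have h32 := filtration_anti (d := 4) (R := R) (show 2 ≤ 3 by decide)
  have h1 : ∀ i j k, (if i < j ∧ k ≤ j then grpComm (grpComm (x i) (x j)) (x k) ^ e i j k else 1)
      ∈ filtration 4 R 3 := by
    intro i j k
    split_ifs
    · exact zpow_mem (grpComm_grpComm_mem_filtration_three _ _ _) _
    · exact one_mem _
  have h2 : ∀ i j k,
      mat (if i < j ∧ k ≤ j then grpComm (grpComm (x i) (x j)) (x k) ^ e i j k else 1) 0 3 =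
      if i < j ∧ k ≤ j then
        cubicForm (superdiag (x i)) (superdiag (x j)) (superdiag (x k)) * (e i j k : R)
      else 0 := by
    intro i j k
    split_ifs
    · rw [(mat_pow_of_mem_filtration_two
        (h32 (grpComm_grpComm_mem_filtration_three _ _ _)) _).2.2, mat_grpComm_grpComm, mul_comm]
    · simp [mat_one]
  have h3 := fun i j => list_prod_mem_and_corner (List.finRange n) _ (h1 i j)
  have h4 := fun i => list_prod_mem_and_corner (List.finRange n) _ fun j => (h3 i j).1
  have h5 := list_prod_mem_and_corner (List.finRange n) _ fun i => (h4 i).1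
  refine ⟨h5.1, ?_⟩
  rw [tripleCommProd, h5.2, ← Fin.sum_univ_def]
  refine Finset.sum_congr rfl fun i _ => ?_
  rw [(h4 i).2, ← Fin.sum_univ_def]
  refine Finset.sum_congr rfl fun j _ => ?_
  rw [(h3 i j).2, ← Fin.sum_univ_def]
  exact Finset.sum_congr rfl fun k _ => h2 i j k

theorem tripleCommProd_eq_one_iff {n : ℕ} (x : Fin n → unipotentGroup 4 R)
    (e : Fin n → Fin n → Fin n → ℤ) :
    tripleCommProd x e = 1 ↔ (∑ i, ∑ j, ∑ k, if i < j ∧ k ≤ j then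
        cubicForm (superdiag (x i)) (superdiag (x j)) (superdiag (x k)) * (e i j k : R) else 0)
      = 0 := by
  obtain ⟨h1, h2⟩ := tripleCommProd_mem_and_corner x e
  rw [← h2]
  exact ⟨fun h => by simp [h, mat_one], eq_one_of_mem_filtration_three h1⟩

/-- The unipotent `4 × 4` matrix with prescribed entries. -/
noncomputable def ofEntries (s u : Fin 3 → R) : unipotentGroup 4 R :=
  ⟨Matrix.GeneralLinearGroup.mk'' !![1, s 0, u 0, u 2; 0, 1, s 1, u 1; 0, 0, 1, s 2; 0, 0, 0, 1]
    (by simp [Matrix.det_succ_row_zero, Fin.sum_univ_succ, Fin.succAbove]),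
    by
      constructor
      · intro i j h
        fin_cases i <;> fin_cases j <;> simp at h <;> rfl
      · intro i
        fin_cases i <;> rfl⟩

/-- Coordinates on the group of unipotent `4 × 4` matrices. -/
noncomputable def entriesEquiv (R : Type*) [CommRing R] :
    unipotentGroup 4 R ≃ (Fin 3 → R) × (Fin 3 → R) where
  toFun g := (superdiag g, ![mat g 0 2, mat g 1 3, mat g 0 3])
  invFun q := ofEntries q.1 q.2
  left_inv g := by
    obtain ⟨g1, g2, g3, g4, g5, g6, g7, g8, g9, g10⟩ := mat_entries g
    apply mat_injective
    ext i j
    fin_cases i <;> fin_cases j <;> first | rfl | exact Eq.symm (by assumption)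
  right_inv q := by
    refine Prod.ext ?_ ?_ <;> ext i <;> fin_cases i <;> rfl

end Four

/-! ### Generation is detected on superdiagonals. -/

section Generation

variable {p : ℕ} [Fact p.Prime]

/-- A Frattini argument by hand: lifts of the standard basis lie in `H`, and their iterated
commutators already fill the third step, then the second, and finally everything. -/
theorem eq_top_of_map_superdiagHom_eq_top (H : Subgroup (unipotentGroup 4 (ZMod p)))
    (hH : H.map (superdiagHom (ZMod p)) = ⊤) : H = ⊤ := by
  have hsup : ∀ s : Fin 3 → ZMod p, ∃ g ∈ H, superdiag g = s := by
    intro s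
    obtain ⟨g, hg, h⟩ : Multiplicative.ofAdd s ∈ H.map (superdiagHom (ZMod p)) := by
      rw [hH]; trivial
    exact ⟨g, hg, congrArg Multiplicative.toAdd h⟩
  have hcomm : ∀ g ∈ H, ∀ h ∈ H, grpComm g h ∈ H := fun g hg h hh =>
    mul_mem (mul_mem (mul_mem (inv_mem hg) (inv_mem hh)) hg) hh
  have h32 := filtration_anti (d := 4) (R := ZMod p) (show 2 ≤ 3 by decide)
  obtain ⟨g0, hg0, e0⟩ := hsup ![1, 0, 0]
  obtain ⟨g1, hg1, e1⟩ := hsup ![0, 1, 0]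
  obtain ⟨g2, hg2, e2⟩ := hsup ![0, 0, 1]
  have H3 : filtration 4 (ZMod p) 3 ≤ H := by
    intro g hg
    obtain ⟨t, ht⟩ := ZMod.intCast_surjective (mat g 0 3)
    have hz := grpComm_grpComm_mem_filtration_three g0 g1 g2
    have hzt : mat (grpComm (grpComm g0 g1) g2 ^ (-t)) 0 3 = -mat g 0 3 := by
      -- At the standard basis the cubic form is `1`, so the power `-t` cancels the corner of `g`.
      rw [(mat_pow_of_mem_filtration_two (h32 hz) _).2.2, mat_grpComm_grpComm, e0, e1, e2]
      simp [cubicForm, ht]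
    have h1 : g * grpComm (grpComm g0 g1) g2 ^ (-t) = 1 := by
      apply eq_one_of_mem_filtration_three (mul_mem hg (zpow_mem hz _))
      rw [(mat_mul_of_mem_filtration_two (h32 hg) (h32 (zpow_mem hz _))).2.2, hzt, add_neg_cancel]
    rw [eq_inv_of_mul_eq_one_left h1]
    exact inv_mem (zpow_mem (hcomm _ (hcomm _ hg0 _ hg1) _ hg2) _)
  have H2 : filtration 4 (ZMod p) 2 ≤ H := by
    intro g hg
    obtain ⟨t, ht⟩ := ZMod.intCast_surjective (mat g 0 2)
    obtain ⟨s, hs⟩ := ZMod.intCast_surjective (mat g 1 3)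
    have hy := grpComm_mem_filtration_two g0 g1
    have hz := grpComm_mem_filtration_two g1 g2
    have hyt := mat_pow_of_mem_filtration_two hy (-t)
    have hzs := mat_pow_of_mem_filtration_two hz (-s)
    rw [(mat_grpComm g0 g1).1, (mat_grpComm g0 g1).2, e0, e1] at hyt
    rw [(mat_grpComm g1 g2).1, (mat_grpComm g1 g2).2, e1, e2] at hzs
    set y := grpComm g0 g1 ^ (-t) with hy'
    -- `[g0, g1]` has entries `(1, 0)` and `[g1, g2]` has `(0, 1)` on the second superdiagonal, so
    -- `y` and `z` clear the two entries of `g` independently.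
    set z := grpComm g1 g2 ^ (-s) with hz'
    have hyF : y ∈ filtration 4 (ZMod p) 2 := zpow_mem hy _
    have hzF : z ∈ filtration 4 (ZMod p) 2 := zpow_mem hz _
    have hyH : y ∈ H := zpow_mem (hcomm _ hg0 _ hg1) _
    have hzH : z ∈ H := zpow_mem (hcomm _ hg1 _ hg2) _
    have h1 : g * y * z ∈ filtration 4 (ZMod p) 3 := by
      rw [mem_filtration_three (mul_mem (mul_mem hg hyF) hzF)]
      have m1 := mat_mul_of_mem_filtration_two (mul_mem hg hyF) hzF
      have m2 := mat_mul_of_mem_filtration_two hg hyF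
      rw [m1.1, m1.2.1, m2.1, m2.2.1, hyt.1, hyt.2.1, hzs.1, hzs.2.1]
      simp [ht, hs]
    exact (Subgroup.mul_mem_cancel_right _ hyH).1
      ((Subgroup.mul_mem_cancel_right _ hzH).1 (H3 h1))
  rw [eq_top_iff]
  intro g _
  obtain ⟨h, hh, e⟩ := hsup (-superdiag g)
  refine (Subgroup.mul_mem_cancel_right _ hh).1 (H2 ?_)
  rw [mem_filtration_two, superdiag_mul, e, add_neg_cancel]

theorem superdiagHom_surjective (R : Type*) [CommRing R] :
    Function.Surjective (superdiagHom R) := by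
  intro s
  have h := (entriesEquiv R).right_inv (Multiplicative.toAdd s, 0)
  exact ⟨ofEntries (Multiplicative.toAdd s) 0, congrArg (fun q => Multiplicative.ofAdd q.1) h⟩

theorem closure_range_eq_top_iff {n : ℕ} (f : Fin n → unipotentGroup 4 (ZMod p)) :
    Subgroup.closure (Set.range f) = ⊤ ↔
      Submodule.span (ZMod p) (Set.range fun i => superdiag (f i)) = ⊤ := by
  have hmap : (Subgroup.closure (Set.range f)).map (superdiagHom (ZMod p)) =
      (AddSubgroup.toSubgroup (Submodule.span (ZMod p)
        (Set.range fun i => superdiag (f i))).toAddSubgroup) := by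
    rw [MonoidHom.map_closure]
    apply le_antisymm
    · rw [Subgroup.closure_le]
      rintro _ ⟨_, ⟨i, rfl⟩, rfl⟩
      change superdiag (f i) ∈ Submodule.span (ZMod p) (Set.range fun i => superdiag (f i))
      exact Submodule.subset_span ⟨i, rfl⟩
    · intro s hs
      have hs' : Multiplicative.toAdd s ∈ Submodule.span (ZMod p)
        (Set.range fun i => superdiag (f i)) := hs
      -- Over `ZMod p` every additive subgroup is a subspace, so the subgroup closure absorbs the
      -- span.
      have key : Submodule.span (ZMod p) (Set.range fun i => superdiag (f i)) ≤
          AddSubgroup.toZModSubmodule p (Subgroup.toAddSubgroup'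
            (Subgroup.closure (superdiagHom (ZMod p) '' Set.range f))) := by
        rw [Submodule.span_le]
        rintro _ ⟨i, rfl⟩
        change Multiplicative.ofAdd (superdiag (f i)) ∈
          Subgroup.closure (superdiagHom (ZMod p) '' Set.range f)
        exact Subgroup.subset_closure ⟨f i, ⟨i, rfl⟩, rfl⟩
      exact key hs'
  constructor
  · intro h
    rw [h, ← MonoidHom.range_eq_map, MonoidHom.range_eq_top (f := superdiagHom (ZMod p)).2
      (superdiagHom_surjective _)] at hmap
    rw [eq_top_iff]
    intro s _
    have : Multiplicative.ofAdd s ∈ (⊤ : Subgroup (Multiplicative (Fin 3 → ZMod p))) := trivial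
    rw [hmap] at this
    exact this
  · intro h
    apply eq_top_of_map_superdiagHom_eq_top
    rw [hmap, h]
    rfl

theorem span_range_eq_top_iff_rank {K : Type*} [Field K] {n : ℕ} (a b c : Fin n → K) :
    Submodule.span K (Set.range fun i => ![a i, b i, c i]) = ⊤ ↔
      (Matrix.of ![a, b, c]).rank = 3 := by
  rw [Matrix.rank_eq_finrank_span_cols]
  have e : (Matrix.of ![a, b, c]).col = fun i => ![a i, b i, c i] := by
    ext i j
    fin_cases j <;> rfl
  rw [e]
  constructor
  · intro h
    rw [h, finrank_top]
    simp
  · intro h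
    apply Submodule.eq_top_of_finrank_eq
    rw [h]
    simp

end Generation

end UnipotentGroup

/-! ### Epimorphisms from a presented pro-p-group as generating tuples. -/

section Lifting

variable {p n r : ℕ} {S : Type*} [Group S] [TopologicalSpace S] [IsTopologicalGroup S]
  {x : Fin n → S}

theorem IsFreeProP.hom_ext (hS : IsFreeProP p S x) {P : Type} [Group P] [Finite P]
    [TopologicalSpace P] [DiscreteTopology P] (hP : IsPGroup p P) {φ ψ : S →ₜ* P}
    (h : ∀ i, φ (x i) = ψ (x i)) : φ = ψ :=
  (hS.existsUnique_lift P hP fun i => ψ (x i)).unique h fun _ => rfl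

theorem IsFreeProP.range_eq_closure (hS : IsFreeProP p S x) {P : Type} [Group P] [Finite P]
    [TopologicalSpace P] [DiscreteTopology P] (hP : IsPGroup p P) (φ : S →ₜ* P) :
    (φ : S →* P).range = Subgroup.closure (Set.range fun i => φ (x i)) := by
  apply le_antisymm
  · set H := Subgroup.closure (Set.range fun i => φ (x i)) with hH
    -- Lifting the generators into `H` itself and using uniqueness shows that `φ` factors through
    -- `H`.
    obtain ⟨ψ, hψ, -⟩ := hS.existsUnique_lift H (hP.to_subgroup H)
      fun i => ⟨φ (x i), Subgroup.subset_closure ⟨i, rfl⟩⟩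
    let ι : H →ₜ* P := ⟨H.subtype, continuous_subtype_val⟩
    have h : φ = ι.comp ψ := hS.hom_ext hP fun i => by
      change φ (x i) = (ψ (x i)).1
      rw [hψ]
    rintro _ ⟨s, rfl⟩
    rw [h]
    exact (ψ s).2
  · rw [Subgroup.closure_le]
    rintro _ ⟨i, rfl⟩
    exact ⟨x i, rfl⟩

theorem closedNormalClosure_le_ker {ι P : Type*} [Group P] [TopologicalSpace P] [DiscreteTopology P]
    {ρ : ι → S} {φ : S →ₜ* P} (h : ∀ m, φ (ρ m) = 1) :
    closedNormalClosure ρ ≤ (φ : S →* P).ker := by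
  refine Subgroup.topologicalClosure_minimal _ (Subgroup.normalClosure_le_normal ?_)
    ((isClosed_discrete ({1} : Set P)).preimage φ.continuous_toFun)
  rintro _ ⟨m, rfl⟩
  exact h m

/-- Epimorphisms from a finitely presented pro-`p`-group to a finite `p`-group correspond to
generating tuples satisfying the relations. -/
theorem IsFreeProP.nonempty_epi_equiv (hS : IsFreeProP p S x) {P : Type} [Group P] [Finite P]
    [TopologicalSpace P] [DiscreteTopology P] (hP : IsPGroup p P) (ρ : Fin r → S)
    (Q : (Fin n → P) → Prop)
    (hQ : ∀ φ : S →ₜ* P, (∀ m, φ (ρ m) = 1) ↔ Q fun i => φ (x i)) :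
    Nonempty (Epi (S ⧸ closedNormalClosure ρ) P ≃
      {f : Fin n → P // Q f ∧ Subgroup.closure (Set.range f) = ⊤}) := by
  let π : S →ₜ* S ⧸ closedNormalClosure ρ :=
    ⟨QuotientGroup.mk' _, QuotientGroup.continuous_mk⟩
  have hπ : Function.Surjective π := QuotientGroup.mk'_surjective _
  have hπρ : ∀ m, π (ρ m) = 1 := fun m => (QuotientGroup.eq_one_iff _).2
    (Subgroup.le_topologicalClosure _ (Subgroup.subset_normalClosure ⟨m, rfl⟩))
  refine ⟨Equiv.ofBijective (fun φ => ⟨fun i => φ.1 (π (x i)), ?_, ?_⟩) ⟨?_, ?_⟩⟩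
  · exact (hQ (φ.1.comp π)).1 fun m => by
      change φ.1 (π (ρ m)) = 1
      rw [hπρ, map_one]
  · have h := hS.range_eq_closure hP (φ.1.comp π)
    rw [MonoidHom.range_eq_top.2 (show Function.Surjective (φ.1 ∘ π) from φ.2.comp hπ)] at h
    exact h.symm
  · intro φ ψ h
    have h' : φ.1.comp π = ψ.1.comp π := hS.hom_ext hP fun i =>
      congrFun (congrArg Subtype.val h) i
    refine Subtype.ext (DFunLike.ext _ _ fun q => ?_)
    obtain ⟨s, rfl⟩ := hπ q
    exact DFunLike.congr_fun h' s
  · rintro ⟨f, hf, hf'⟩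
    obtain ⟨φ, hφ, -⟩ := hS.existsUnique_lift P hP f
    obtain rfl : (fun i => φ (x i)) = f := funext hφ
    have hker := closedNormalClosure_le_ker ((hQ φ).2 hf)
    let ψ : S ⧸ closedNormalClosure ρ →ₜ* P :=
      ⟨QuotientGroup.lift _ (φ : S →* P) hker, φ.continuous_toFun.quotient_lift _⟩
    refine ⟨⟨ψ, fun y => ?_⟩, rfl⟩
    have hr := hS.range_eq_closure hP φ
    rw [hf', MonoidHom.range_eq_top] at hr
    obtain ⟨s, hs⟩ := hr y
    exact ⟨π s, hs⟩

end Lifting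

/-! ### Counting the tuples. -/

section Counting

open UnipotentGroup

/-- Tuples of unipotent `4 × 4` matrices, sorted by their superdiagonals. -/
noncomputable def tupleEquiv (n : ℕ) (R : Type*) [CommRing R] : (Fin n → unipotentGroup 4 R) ≃
    ((Fin n → R) × (Fin n → R) × (Fin n → R)) × (Fin n → Fin 3 → R) where
  toFun f := ((fun i => superdiag (f i) 0, fun i => superdiag (f i) 1,
    fun i => superdiag (f i) 2), fun i => (entriesEquiv R (f i)).2)
  invFun q := fun i => (entriesEquiv R).symm (![q.1.1 i, q.1.2.1 i, q.1.2.2 i], q.2 i)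
  left_inv f := by
    funext i
    rw [Equiv.symm_apply_eq]
    refine Prod.ext ?_ rfl
    ext j
    fin_cases j <;> rfl
  right_inv q := by
    have h := fun i => (entriesEquiv R).apply_symm_apply (![q.1.1 i, q.1.2.1 i, q.1.2.2 i], q.2 i)
    have h1 := fun i => congrArg Prod.fst (h i)
    have h2 := fun i => congrArg Prod.snd (h i)
    refine Prod.ext (Prod.ext ?_ (Prod.ext ?_ ?_)) (funext h2)
    · exact funext fun i => congrFun (h1 i) 0
    · exact funext fun i => congrFun (h1 i) 1
    · exact funext fun i => congrFun (h1 i) 2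

theorem card_relation_tuples (p : ℕ) [Fact p.Prime] (n r : ℕ)
    (e : Fin n → Fin n → Fin n → Fin r → ℤ) :
    Nat.card {f : Fin n → unipotentGroup 4 (ZMod p) //
      (∀ m, tripleCommProd f (fun i j k => e i j k m) = 1) ∧
        Subgroup.closure (Set.range f) = ⊤} =
      (cubicSolutions p n r e).ncard * p ^ (3 * n) := by
  have hiff : ∀ f : Fin n → unipotentGroup 4 (ZMod p),
      ((∀ m, tripleCommProd f (fun i j k => e i j k m) = 1) ∧
        Subgroup.closure (Set.range f) = ⊤) ↔
      (tupleEquiv n (ZMod p) f).1 ∈ cubicSolutions p n r e := by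
    intro f
    refine and_congr (forall_congr' fun m => tripleCommProd_eq_one_iff f _) ?_
    rw [closure_range_eq_top_iff, ← span_range_eq_top_iff_rank]
    have h : ∀ i, superdiag (f i) =
        ![superdiag (f i) 0, superdiag (f i) 1, superdiag (f i) 2] := by
      intro i
      ext j
      fin_cases j <;> rfl
    rw [funext h]
    rfl
  rw [Nat.card_congr (Equiv.subtypeEquiv (tupleEquiv n (ZMod p)) hiff :
    _ ≃ {q : ((Fin n → ZMod p) × (Fin n → ZMod p) × (Fin n → ZMod p)) × (Fin n → Fin 3 → ZMod p) //
      q.1 ∈ cubicSolutions p n r e}),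
    Nat.card_congr (Equiv.prodSubtypeFstEquivSubtypeProd
      (p := fun t => t ∈ cubicSolutions p n r e)), Nat.card_prod]
  congr 1
  simp [Nat.card_eq_fintype_card, ZMod.card, pow_mul]

theorem map_tripleCommProd {n : ℕ} {G H : Type*} [Group G] [Group H] (φ : G →* H) (x : Fin n → G)
    (e : Fin n → Fin n → Fin n → ℤ) :
    φ (tripleCommProd x e) = tripleCommProd (fun i => φ (x i)) e := by
  simp only [tripleCommProd, map_list_prod, List.map_map]
  congr 2
  funext i
  simp only [Function.comp_apply, map_list_prod, List.map_map]
  congr 2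
  funext j
  simp only [Function.comp_apply, map_list_prod, List.map_map]
  congr 2
  funext k
  simp only [Function.comp_apply]
  split_ifs <;> simp [grpComm]

end Counting

open UnipotentGroup in
theorem mainTheorem8 (p : ℕ) [Fact p.Prime] (n r : ℕ)
    {S : Type*} [Group S] [TopologicalSpace S] [IsTopologicalGroup S]
    (x : Fin n → S) (hS : IsFreeProP p S x)
    (ρ : Fin r → S) (e : Fin n → Fin n → Fin n → Fin r → ℤ)
    (hρ : ∀ m, (ρ m)⁻¹ * tripleCommProd x (fun i j k => e i j k m) ∈ zassenhaus p S 4) :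
    Finite (Epi (S ⧸ closedNormalClosure ρ) (unipotentGroup 4 (ZMod p))) ∧
      Nat.card (Epi (S ⧸ closedNormalClosure ρ) (unipotentGroup 4 (ZMod p))) =
        (cubicSolutions p n r e).ncard * p ^ (3 * n) := by
  have : DiscreteTopology (GL (Fin 4) (ZMod p)) :=
    Units.isEmbedding_embedProduct.discreteTopology
  obtain ⟨E⟩ := hS.nonempty_epi_equiv (isPGroup_unipotentGroup 4 (ZMod p) p) ρ
    (fun f => ∀ m, tripleCommProd f (fun i j k => e i j k m) = 1) fun φ => forall_congr' fun m => by
      -- `φ` kills the fourth Zassenhaus subgroup, so the relator and the triple commutator product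
      -- have the same image.
      have h := map_mem_filtration_of_mem_zassenhaus (p := p) φ 4 (hρ m)
      rw [filtration_self, Subgroup.mem_comap, Subgroup.mem_bot, map_mul, map_inv,
        inv_mul_eq_one] at h
      exact Eq.congr_left (h.trans (map_tripleCommProd (φ : S →* unipotentGroup 4 (ZMod p)) _ _))
  exact ⟨Finite.of_equiv _ E.symm, (Nat.card_congr E).trans (card_relation_tuples p n r e)⟩
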